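/- Let $G$ be a real Lie group with Lie algebra $\mathfrak g$, and suppose that the complexification $\mathfrak g_{\mathbb C}=\mathbb C\otimes_{\mathbb R}\mathfrak g$ is a simple complex Lie algebra. Let $B$ be the Killing form of $\mathfrak g$, let $\mathfrak g=\mathfrak k+\mathfrak p$ be a Cartan decomposition, let $\mathfrak a\subseteq\mathfrak p$ be a subspace that is maximal among the subspaces of $\mathfrak p$ whose elements commute, and for $\lambda\in\mathfrak a^*$ put $\mathfrak g_\lambda=\{X\in\mathfrak g : [A,X]=\lambda(A)X \text{ for all } A\in\mathfrak a\}$. The restricted roots are the $\lambda\neq0$ with $\mathfrak g_\lambda\neq0$. Let $\Delta$ be a set of simple restricted roots (for some choice of positive restricted roots) and let $\Theta\subsetneq\Delta$ be a proper subset. The level of $\lambda=\sum_{\alpha\in\Delta}c_\alpha\alpha$, $c_\alpha\in\mathbb Z$, is $\sum_{\alpha\in\Delta\setminus\Theta}c_\alpha$. For $k\in\mathbb Z$ let $\mathfrak g_k$ be the sum of the spaces $\mathfrak g_\lambda$ over all $\lambda$ of level $k$ that are restricted roots or zero, and put $$\mathfrak n_\Theta^+=\bigoplus_{k>0}\mathfrak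 g_k,\qquad \mathfrak n_\Theta^-=\bigoplus_{k<0}\mathfrak g_k,\qquad \mathfrak l_\Theta=\mathfrak g_0\ \text{(the Levi subalgebra)},$$ $$\mathfrak a_\Theta=\{A\in\mathfrak a:\alpha(A)=0\text{ for all }\alpha\in\Theta\},\qquad \mathfrak m_\Theta=\{X\in\mathfrak l_\Theta: B(A,X)=0\text{ for all }A\in\mathfrak a_\Theta\},$$ so that $\mathfrak l_\Theta=\mathfrak a_\Theta\oplus\mathfrak m_\Theta$; $\mathfrak m_\Theta$ is the (generalized) Lorentz algebra. Let $A_\Theta$ be the connected subgroup of $G$ with Lie algebra $\mathfrak a_\Theta$, that is, the subgroup generated by $\exp(\mathfrak a_\Theta)$ (the dilatation group). Suppose that $[\mathfrak n_\Theta^+,\mathfrak n_\Theta^-]\subseteq\mathfrak l_\Theta$. Then $\mathfrak n_\Theta^+$ is an irreducible $\mathfrak m_\Theta$-module under the Lie bracket, and every $x\in A_\Theta$ acts on $\mathfrak n_\Theta^+$, through the adjoint action $\mathrm{Ad}(x)$, as multiplication by a positive constant. -/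

import Mathlib

open scoped Manifold ContDiff TensorProduct

noncomputable section

/-! ### Lie groups: adjoint action and connected subgroups -/

/-- A smooth Lie group is in particular regular enough for its Lie algebra to be defined. -/
instance LieGroup.minSmoothness_of_infty
    {E : Type*} [NormedAddCommGroup E] [NormedSpace ℝ E]
    {H : Type*} [TopologicalSpace H] {I : ModelWithCorners ℝ E H}
    {G : Type*} [TopologicalSpace G] [ChartedSpace H G] [Group G] [LieGroup I ∞ G] :
    LieGroup I (minSmoothness ℝ 3) G :=
  LieGroup.of_le (n := ∞) (by
    rw [minSmoothness_of_isRCLikeNormedField]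
    exact WithTop.coe_le_coe.2 le_top)

section LieGroups

variable {E : Type*} [NormedAddCommGroup E] [NormedSpace ℝ E]
  {H : Type*} [TopologicalSpace H] (I : ModelWithCorners ℝ E H)
  {G : Type*} [TopologicalSpace G] [ChartedSpace H G] [Group G]

/-- The adjoint action `Ad x` of a group element `x` on the Lie algebra: the derivative at the
identity of the conjugation `y ↦ x y x⁻¹`. -/
def adjointAction (x : G) : GroupLieAlgebra I G →L[ℝ] GroupLieAlgebra I G :=
  mfderiv I I (fun y : G => x * y * x⁻¹) 1

/-- `γ` is the smooth one-parameter subgroup `t ↦ exp (t X)` of `G` with initial velocity `X`. -/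
structure IsOneParameterSubgroup (γ : ℝ → G) (X : GroupLieAlgebra I G) : Prop where
  smooth : ContMDiff 𝓘(ℝ, ℝ) I ∞ γ
  map_add : ∀ s t, γ (s + t) = γ s * γ t
  velocity : (mfderiv 𝓘(ℝ, ℝ) I γ 0 (1 : ℝ) : E) = X

/-- The connected subgroup of `G` with Lie algebra `h`: the subgroup generated by the elements
`exp X`, `X ∈ h`. -/
def connectedSubgroup [CompleteSpace E] [LieGroup I (minSmoothness ℝ 3) G]
    (h : LieSubalgebra ℝ (GroupLieAlgebra I G)) : Subgroup G :=
  Subgroup.closure {x | ∃ X ∈ h, ∃ γ : ℝ → G, IsOneParameterSubgroup I γ X ∧ γ 1 = x}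

end LieGroups

/-! ### Cartan involutions, restricted roots, levels -/

section LieAlgebras

variable {g : Type*} [LieRing g] [LieAlgebra ℝ g]

/-- A Cartan involution `θ` of a real Lie algebra; its eigenspaces `k` (eigenvalue `1`) and
`p` (eigenvalue `-1`) form a Cartan decomposition `g = k + p`. -/
structure IsCartanInvolution (θ : g ≃ₗ⁅ℝ⁆ g) : Prop where
  involutive : ∀ X, θ (θ X) = X
  pos_def : ∀ X, X ≠ 0 → 0 < -killingForm ℝ g X (θ X)

/-- The noncompact part `p` of the Cartan decomposition. -/
def cartanP (θ : g ≃ₗ⁅ℝ⁆ g) : Submodule ℝ g where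
  carrier := {X | θ X = -X}
  add_mem' := by
    intro X Y hX hY
    simp only [Set.mem_ofPred_eq] at *
    rw [map_add, hX, hY]; abel
  zero_mem' := by simp
  smul_mem' := by
    intro c X hX
    simp only [Set.mem_ofPred_eq] at *
    rw [map_smul, hX, smul_neg]

/-- `a` is maximal among the subspaces of `p` whose elements commute. -/
def IsMaximalCommutingIn (p a : Submodule ℝ g) : Prop :=
  Maximal (fun b : Submodule ℝ g => b ≤ p ∧ ∀ X ∈ b, ∀ Y ∈ b, ⁅X, Y⁆ = 0) a

/-- The simultaneous eigenspace `g_lam = {X | [A, X] = lam(A) X for all A ∈ a}`. -/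
def restrictedRootSpace (a : Submodule ℝ g) (lam : Module.Dual ℝ a) : Submodule ℝ g where
  carrier := {X | ∀ A : a, ⁅(A : g), X⁆ = lam A • X}
  add_mem' := by
    intro X Y hX hY A
    rw [lie_add, hX A, hY A, smul_add]
  zero_mem' := by intro A; simp
  smul_mem' := by
    intro c X hX A
    rw [lie_smul, hX A, smul_comm]

/-- The restricted roots: the nonzero functionals on `a` with a nonzero eigenspace. -/
def restrictedRoots (a : Submodule ℝ g) : Set (Module.Dual ℝ a) :=
  {lam | lam ≠ 0 ∧ restrictedRootSpace a lam ≠ ⊥}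

/-- `lam` is the combination of the elements of `Δ` with integer coefficients `c`. -/
def IsIntegralExpansion {V : Type*} [AddCommGroup V] (Δ : Set V) (c : V →₀ ℤ) (lam : V) : Prop :=
  (c.support : Set V) ⊆ Δ ∧ lam = c.sum fun α k => k • α

/-- `Δ` is a set of simple restricted roots: it is linearly independent and every restricted root
is an integral combination of elements of `Δ` with coefficients all `≥ 0` (the positive
restricted roots) or all `≤ 0` (the negative ones). -/
structure IsSimpleSystem (a : Submodule ℝ g) (Δ : Set (Module.Dual ℝ a)) : Prop where
  subset : Δ ⊆ restrictedRoots a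
  linearIndep : LinearIndepOn ℝ id Δ
  expansion : ∀ lam ∈ restrictedRoots a, ∃ c : Module.Dual ℝ a →₀ ℤ,
    IsIntegralExpansion Δ c lam ∧ ((∀ α, 0 ≤ c α) ∨ (∀ α, c α ≤ 0))

open Classical in
/-- `lam` has level `k` with respect to `Θ ⊆ Δ`: the sum of the coefficients of `lam` at the
elements of `Δ \ Θ` is `k`. -/
def HasLevel {V : Type*} [AddCommGroup V] (Δ Θ : Set V) (lam : V) (k : ℤ) : Prop :=
  ∃ c : V →₀ ℤ, IsIntegralExpansion Δ c lam ∧ k = c.sum fun α m => if α ∈ Θ then 0 else m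

lemma HasLevel.add {V : Type*} [AddCommGroup V] {Δ Θ : Set V} {lam mu : V} {k l : ℤ}
    (h : HasLevel Δ Θ lam k) (h' : HasLevel Δ Θ mu l) : HasLevel Δ Θ (lam + mu) (k + l) := by
  classical
  obtain ⟨c, ⟨hc, rfl⟩, rfl⟩ := h
  obtain ⟨d, ⟨hd, rfl⟩, rfl⟩ := h'
  refine ⟨c + d, ⟨?_, ?_⟩, ?_⟩
  · intro x hx
    rcases Finset.mem_union.1 (Finsupp.support_add hx) with h | h
    · exact hc h
    · exact hd h
  · rw [Finsupp.sum_add_index'] <;> simp [add_smul]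
  · rw [Finsupp.sum_add_index']
    · simp
    · intro a b₁ b₂; split_ifs <;> simp

lemma HasLevel.zero {V : Type*} [AddCommGroup V] (Δ Θ : Set V) : HasLevel Δ Θ 0 0 :=
  ⟨0, ⟨by simp, by simp⟩, by simp⟩

/-- The graded piece `g_k`: the sum of the spaces `g_lam`, where `lam` is zero or a restricted
root and has level `k`. For `lam = 0` this is the centralizer of `a`. -/
def gradedPiece (a : Submodule ℝ g) (Δ Θ : Set (Module.Dual ℝ a)) (k : ℤ) : Submodule ℝ g :=
  ⨆ lam ∈ {lam | (lam = 0 ∨ lam ∈ restrictedRoots a) ∧ HasLevel Δ Θ lam k},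
    restrictedRootSpace a lam

lemma lie_mem_restrictedRootSpace {a : Submodule ℝ g} {lam mu : Module.Dual ℝ a} {X Y : g}
    (hX : X ∈ restrictedRootSpace a lam) (hY : Y ∈ restrictedRootSpace a mu) :
    ⁅X, Y⁆ ∈ restrictedRootSpace a (lam + mu) := by
  intro A
  rw [leibniz_lie, hX A, hY A, smul_lie, lie_smul, LinearMap.add_apply, add_smul]

lemma lie_mem_gradedPiece {a : Submodule ℝ g} {Δ Θ : Set (Module.Dual ℝ a)} {k l : ℤ} {X Y : g}
    (hX : X ∈ gradedPiece a Δ Θ k) (hY : Y ∈ gradedPiece a Δ Θ l) :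
    ⁅X, Y⁆ ∈ gradedPiece a Δ Θ (k + l) := by
  unfold gradedPiece at hX hY
  rw [iSup_subtype'] at hX hY
  induction hX using Submodule.iSup_induction' with
  | zero => simp
  | add X₁ X₂ _ _ h₁ h₂ => rw [add_lie]; exact add_mem h₁ h₂
  | mem lam X hX =>
    induction hY using Submodule.iSup_induction' with
    | zero => simp
    | add Y₁ Y₂ _ _ h₁ h₂ => rw [lie_add]; exact add_mem h₁ h₂
    | mem mu Y hY =>
      have hXY := lie_mem_restrictedRootSpace hX hY
      by_cases h : restrictedRootSpace a (lam.1 + mu.1) = ⊥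
      · rw [h, Submodule.mem_bot] at hXY
        rw [hXY]; exact zero_mem _
      · refine Submodule.mem_iSup_of_mem (lam.1 + mu.1) (Submodule.mem_iSup_of_mem ?_ hXY)
        refine ⟨?_, lam.2.2.add mu.2.2⟩
        by_cases h0 : lam.1 + mu.1 = 0
        · exact Or.inl h0
        · exact Or.inr ⟨h0, h⟩

/-- The common zeros in `a` of the functionals in `Θ`. -/
def commonKernel (a : Submodule ℝ g) (Θ : Set (Module.Dual ℝ a)) : Submodule ℝ g :=
  (⨅ lam ∈ Θ, LinearMap.ker lam).map a.subtype

lemma mem_commonKernel {a : Submodule ℝ g} {Θ : Set (Module.Dual ℝ a)} {X : g} :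
    X ∈ commonKernel a Θ ↔ ∃ hX : X ∈ a, ∀ lam ∈ Θ, lam ⟨X, hX⟩ = 0 := by
  simp [commonKernel, Submodule.mem_iInf]

lemma IsIntegralExpansion.unique {V : Type*} [AddCommGroup V] [Module ℝ V] {Δ : Set V}
    (hΔ : LinearIndepOn ℝ id Δ) {c d : V →₀ ℤ} {lam : V} (hc : IsIntegralExpansion Δ c lam)
    (hd : IsIntegralExpansion Δ d lam) : c = d := by
  have h : LinearIndepOn ℤ id Δ := LinearIndependent.restrict_scalars' (R := ℤ) (K := ℝ) hΔ
  rw [linearIndepOn_iff] at h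
  rw [← sub_eq_zero]
  apply h
  · rw [Finsupp.mem_supported]
    intro x hx
    classical
    rcases Finset.mem_union.1 (Finsupp.support_sub hx) with h | h
    · exact hc.1 h
    · exact hd.1 h
  · rw [map_sub, sub_eq_zero]
    exact hc.2.symm.trans hd.2

/-- A restricted root of level zero vanishes on the common kernel of `Θ`. -/
lemma IsSimpleSystem.apply_eq_zero {a : Submodule ℝ g} {Δ Θ : Set (Module.Dual ℝ a)}
    (hΔ : IsSimpleSystem a Δ) {lam : Module.Dual ℝ a} (hlam : lam = 0 ∨ lam ∈ restrictedRoots a)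
    (h : HasLevel Δ Θ lam 0) (A : a) (hA : ∀ mu ∈ Θ, mu A = 0) : lam A = 0 := by
  classical
  rcases hlam with rfl | hlam
  · simp
  obtain ⟨c, hc, hsum⟩ := h
  obtain ⟨d, hd, hsign⟩ := hΔ.expansion lam hlam
  obtain rfl := hc.unique hΔ.linearIndep hd
  have hz : ∀ α, α ∉ Θ → c α = 0 := by
    intro α hα
    by_contra hne
    have hmem : α ∈ c.support := Finsupp.mem_support_iff.2 hne
    have := hsum.symm
    rw [Finsupp.sum] at this
    rcases hsign with hs | hs
    · have := (Finset.sum_eq_zero_iff_of_nonneg (by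
        intro β _; split_ifs; exacts [le_rfl, hs β])).1 this α hmem
      exact hne (by simpa [hα] using this)
    · have := (Finset.sum_eq_zero_iff_of_nonpos (by
        intro β _; split_ifs; exacts [le_rfl, hs β])).1 this α hmem
      exact hne (by simpa [hα] using this)
  rw [hc.2, Finsupp.sum, LinearMap.sum_apply]
  refine Finset.sum_eq_zero fun α _ => ?_
  by_cases hα : α ∈ Θ
  · simp [hA α hα]
  · simp [hz α hα]

lemma lie_commonKernel_eq_zero {a : Submodule ℝ g} {Δ Θ : Set (Module.Dual ℝ a)}
    (hΔ : IsSimpleSystem a Δ) {A X : g} (hA : A ∈ commonKernel a Θ)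
    (hX : X ∈ gradedPiece a Δ Θ 0) : ⁅A, X⁆ = 0 := by
  obtain ⟨ha, hA⟩ := mem_commonKernel.1 hA
  unfold gradedPiece at hX
  rw [iSup_subtype'] at hX
  induction hX using Submodule.iSup_induction' with
  | zero => simp
  | add X₁ X₂ _ _ h₁ h₂ => rw [lie_add, h₁, h₂, add_zero]
  | mem lam X hX => rw [hX ⟨A, ha⟩, hΔ.apply_eq_zero lam.2.1 lam.2.2 _ hA, zero_smul]

/-! ### Standard parabolic subalgebras -/

variable (g) in
/-- The data which determine a (proper) standard parabolic subalgebra of `g`: a Cartan involution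
`θ`, a maximal commuting subspace `a` of `p`, a set `simple` of simple restricted roots (that is,
a choice of positive restricted roots), and a proper subset `Θ` of it. -/
structure StandardParabolic where
  θ : g ≃ₗ⁅ℝ⁆ g
  isCartanInvolution : IsCartanInvolution θ
  a : Submodule ℝ g
  isMaximalCommuting : IsMaximalCommutingIn (cartanP θ) a
  simple : Set (Module.Dual ℝ a)
  isSimpleSystem : IsSimpleSystem a simple
  Θ : Set (Module.Dual ℝ a)
  ssubset : Θ ⊂ simple

namespace StandardParabolic

variable (P : StandardParabolic g)

/-- The piece `g_k` of the grading of `g` by the level. -/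
def piece (k : ℤ) : Submodule ℝ g := gradedPiece P.a P.simple P.Θ k

/-- The Levi subalgebra `l_Θ = g_0`. -/
def levi : LieSubalgebra ℝ g where
  toSubmodule := P.piece 0
  lie_mem' := fun {X Y} hX hY => by
    have h : ⁅X, Y⁆ ∈ P.piece (0 + 0) := lie_mem_gradedPiece hX hY
    rwa [add_zero] at h

/-- The subalgebra `n_Θ^-`, the sum of the pieces of negative level, as a subspace. -/
def nilMinus : Submodule ℝ g := ⨆ k : {k : ℤ // k < 0}, P.piece k

/-- The dilatation algebra `a_Θ`: the elements of `a` on which all elements of `Θ` vanish. -/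
def dilatation : LieSubalgebra ℝ g where
  toSubmodule := commonKernel P.a P.Θ
  lie_mem' := fun {X Y} hX hY => by
    obtain ⟨hX, -⟩ := mem_commonKernel.1 hX
    obtain ⟨hY, -⟩ := mem_commonKernel.1 hY
    rw [P.isMaximalCommuting.prop.2 X hX Y hY]
    exact (commonKernel P.a P.Θ).zero_mem

/-- The Lorentz algebra `m_Θ`: the orthogonal complement of `a_Θ` in the Levi subalgebra with
respect to the Killing form. -/
def lorentz : LieSubalgebra ℝ g where
  carrier := {X | X ∈ P.levi ∧ ∀ A ∈ P.dilatation, killingForm ℝ g A X = 0}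
  add_mem' := fun hX hY =>
    ⟨add_mem hX.1 hY.1, fun A hA => by rw [map_add, hX.2 A hA, hY.2 A hA, add_zero]⟩
  zero_mem' := ⟨zero_mem _, fun A _ => by simp⟩
  smul_mem' := fun c X hX =>
    ⟨P.levi.smul_mem c hX.1, fun A hA => by rw [map_smul, hX.2 A hA, smul_zero]⟩
  lie_mem' := fun {X Y} hX hY => ⟨P.levi.lie_mem hX.1 hY.1, fun A hA => by
    have h0 : ⁅A, X⁆ = 0 := lie_commonKernel_eq_zero P.isSimpleSystem hA hX.1
    have h := LieModule.traceForm_apply_lie_apply ℝ g g A X Y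
    rw [h0, map_zero, LinearMap.zero_apply] at h
    exact h.symm⟩

/-- The subalgebra `n_Θ^+`, the sum of the pieces of positive level, as a module for the Lorentz
algebra under the bracket of `g`. -/
def nilPlus : LieSubmodule ℝ P.lorentz g where
  toSubmodule := ⨆ k : {k : ℤ // 0 < k}, P.piece k
  lie_mem := fun {X Y} hY => by
    change Y ∈ ⨆ k : {k : ℤ // 0 < k}, P.piece k at hY
    change ⁅(X : g), Y⁆ ∈ ⨆ k : {k : ℤ // 0 < k}, P.piece k
    induction hY using Submodule.iSup_induction' with
    | zero => simp
    | add Y₁ Y₂ _ _ h₁ h₂ => rw [lie_add]; exact add_mem h₁ h₂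
    | mem k Y hY =>
      refine Submodule.mem_iSup_of_mem k ?_
      have := lie_mem_gradedPiece X.2.1 hY
      rwa [zero_add] at this

end StandardParabolic

end LieAlgebras

end

/-! Write `N` for the nilradical, `L` for the Levi subalgebra and `B` for the Killing form. The form
`-B(X, θ Y)` is an inner product for which `ad A`, `A ∈ a`, is symmetric, so `g` is the sum of its
simultaneous eigenspaces and `g = N + L + θ N`. The form `B` vanishes on `N × L` and on `N × N`
because levels must cancel. With `[N, θ N] ⊆ L` this forces `N` to be commutative
(`lie_nil_eq_zero`).

The core is `IsShortDecomposition.eq_bot_or_eq`. Let `V ⊆ N` be `L`-stable, `W` its orthogonal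
complement in `N`, and `K` the centralizer of `W + θ W` in `L`. Then `[V, θ W] = 0`, so `V + K + θ
V` is an ideal. It contains `V` and is orthogonal to `W`. Since `g` has no proper nonzero ideal, `V
= 0` or `W = 0`.

An element `A` of the dilatation algebra commutes with `L`, so the eigenspaces of `ad A` in `N` are
`L`-stable and `A` acts on `N` by a scalar (`exists_dilatation_scalar`). As `L` is the dilatation
algebra plus the Lorentz algebra, stability under the latter already gives stability under `L`,
whence irreducibility. On the group side, `Ad (exp (t A)) X` has derivative `[A, X]` at `t = 0`;
hence `[A, X] = c X` integrates to `Ad (exp (t A)) X = exp (c t) X`, and positive scalars are closed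
under products and inverses. -/

/-! ### The inner product of a Cartan involution and simultaneous diagonalization. -/

section CartanInvolution

variable {g : Type*} [LieRing g] [LieAlgebra ℝ g]

lemma killingForm_lie_left (X Y Z : g) :
    killingForm ℝ g ⁅X, Y⁆ Z = killingForm ℝ g X ⁅Y, Z⁆ :=
  LieModule.traceForm_apply_lie_apply ℝ g g X Y Z

lemma killingForm_symm (X Y : g) : killingForm ℝ g X Y = killingForm ℝ g Y X :=
  LieModule.traceForm_comm ℝ g g X Y

namespace IsCartanInvolution

variable {θ : g ≃ₗ⁅ℝ⁆ g} (hθ : IsCartanInvolution θ)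
include hθ

lemma killingForm_apply_left (X Y : g) :
    killingForm ℝ g (θ X) Y = killingForm ℝ g X (θ Y) := by
  rw [← LieAlgebra.killingForm_of_equiv_apply θ X (θ Y), hθ.involutive]

lemma eq_zero_of_killingForm_apply_self {X : g} (h : killingForm ℝ g X (θ X) = 0) : X = 0 := by
  by_contra hX
  have := hθ.pos_def X hX
  rw [h] at this
  simp at this

/-- The inner product `-B(X, θ Y)` attached to a Cartan involution. -/
noncomputable abbrev innerProductCore : InnerProductSpace.Core ℝ g where
  inner X Y := -killingForm ℝ g X (θ Y)
  conj_inner_symm X Y := by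
    simp [killingForm_symm Y, hθ.killingForm_apply_left]
  re_inner_nonneg X := by
    by_cases hX : X = 0
    · simp [hX]
    · simpa using (hθ.pos_def X hX).le
  add_left X Y Z := by simp; ring
  smul_left X Y c := by simp
  definite X h := hθ.eq_zero_of_killingForm_apply_self (by simpa using h)

/-- Orthogonal projection to a subspace with respect to `-B(X, θ Y)`. -/
lemma exists_sub_orthogonal [FiniteDimensional ℝ g] (V : Submodule ℝ g) (X : g) :
    ∃ Y ∈ V, ∀ Z ∈ V, killingForm ℝ g Z (θ (X - Y)) = 0 := by
  let _ := hθ.innerProductCore.toNormedAddCommGroup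
  let _ : InnerProductSpace ℝ g := InnerProductSpace.ofCore hθ.innerProductCore.toCore
  obtain ⟨Y, hY, Z, hZ, rfl⟩ := V.exists_add_mem_mem_orthogonal X
  refine ⟨Y, hY, fun U hU => ?_⟩
  have h : -killingForm ℝ g U (θ Z) = 0 := hZ U hU
  rw [add_sub_cancel_left]
  linarith

/-- A commuting subspace of `p` acts on `g` by simultaneously diagonalizable endomorphisms. -/
lemma iSup_restrictedRootSpace [FiniteDimensional ℝ g] {a : Submodule ℝ g}
    (ha : a ≤ cartanP θ) (hcomm : ∀ X ∈ a, ∀ Y ∈ a, ⁅X, Y⁆ = 0) :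
    ⨆ lam : Module.Dual ℝ a, restrictedRootSpace a lam = ⊤ := by
  let _ := hθ.innerProductCore.toNormedAddCommGroup
  let _ : InnerProductSpace ℝ g := InnerProductSpace.ofCore hθ.innerProductCore.toCore
  let T : a → g →ₗ[ℝ] g := fun A => LieAlgebra.ad ℝ g (A : g)
  have hT : ∀ A, (T A).IsSymmetric := by
    intro A X Y
    change -killingForm ℝ g ⁅(A : g), X⁆ (θ Y) = -killingForm ℝ g X (θ ⁅(A : g), Y⁆)
    have hA : θ (A : g) = -A := ha A.2
    rw [LieEquiv.map_lie, hA, neg_lie, ← lie_skew (A : g) X, map_neg (killingForm ℝ g),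
      LinearMap.neg_apply, killingForm_lie_left, map_neg]
  have hC : Pairwise (Function.onFun Commute T) := by
    intro A A' _
    ext X
    change ⁅(A : g), ⁅(A' : g), X⁆⁆ = ⁅(A' : g), ⁅(A : g), X⁆⁆
    rw [leibniz_lie, hcomm A A.2 A' A'.2, zero_lie, zero_add]
  rw [eq_top_iff, ← LinearMap.IsSymmetric.iSup_iInf_eq_top_of_commute hT hC]
  refine iSup_le fun χ => ?_
  -- The family `χ` is an arbitrary function of `A`; it is forced to be linear only when some
  -- nonzero vector realizes it.
  by_cases hχ : (⨅ A, Module.End.eigenspace (T A) (χ A)) = ⊥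
  · rw [hχ]; exact bot_le
  have key : ∀ X ∈ ⨅ A, Module.End.eigenspace (T A) (χ A), ∀ A : a, ⁅(A : g), X⁆ = χ A • X :=
    fun X hX A => Module.End.mem_eigenspace_iff.1 ((Submodule.mem_iInf _).1 hX A)
  obtain ⟨X, hX, hX0⟩ := Submodule.exists_mem_ne_zero_of_ne_bot hχ
  have hk := key X hX
  let lam : Module.Dual ℝ a :=
    { toFun := χ
      map_add' := fun A A' => smul_left_injective ℝ hX0 (by
        change χ (A + A') • X = (χ A + χ A') • X
        rw [← hk, Submodule.coe_add, add_lie, hk, hk, add_smul])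
      map_smul' := fun c A => smul_left_injective ℝ hX0 (by
        change χ (c • A) • X = (c * χ A) • X
        rw [← hk, Submodule.coe_smul, smul_lie, hk, mul_smul]) }
  exact le_iSup_of_le lam fun Y hY => key Y hY

end IsCartanInvolution

lemma LieEquiv.apply_mem_restrictedRootSpace {θ : g ≃ₗ⁅ℝ⁆ g} {a : Submodule ℝ g} (ha : a ≤ cartanP θ)
    {lam : Module.Dual ℝ a} {X : g} (hX : X ∈ restrictedRootSpace a lam) :
    θ X ∈ restrictedRootSpace a (-lam) := by
  intro A
  have hA : θ (A : g) = -A := ha A.2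
  have h := congrArg θ (hX A)
  rw [LieEquiv.map_lie, hA, map_smul, neg_lie] at h
  rw [LinearMap.neg_apply, neg_smul, ← h, neg_neg]

end CartanInvolution

/-! ### Irreducibility of the nilradical under the Levi subalgebra. -/

section IrreducibleNilradical

variable {g : Type*} [LieRing g] [LieAlgebra ℝ g]

/-- Subspaces `N` and `θ N` of a decomposition `g = N + L + θ N` which behave like the nilradical
of a parabolic subalgebra, its opposite, and the common Levi subalgebra, when `[N, θ N] ⊆ L`. -/
structure IsShortDecomposition (θ : g ≃ₗ⁅ℝ⁆ g) (L N : Submodule ℝ g) : Prop where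
  apply_mem : ∀ X ∈ L, θ X ∈ L
  lie_levi_levi : ∀ X ∈ L, ∀ Y ∈ L, ⁅X, Y⁆ ∈ L
  lie_levi_nil : ∀ X ∈ L, ∀ Y ∈ N, ⁅X, Y⁆ ∈ N
  lie_nil_nil : ∀ X ∈ N, ∀ Y ∈ N, ⁅X, Y⁆ ∈ N
  lie_nil_opp : ∀ X ∈ N, ∀ Y ∈ N, ⁅X, θ Y⁆ ∈ L
  killing_nil_levi : ∀ X ∈ N, ∀ Y ∈ L, killingForm ℝ g X Y = 0
  killing_nil_nil : ∀ X ∈ N, ∀ Y ∈ N, killingForm ℝ g X Y = 0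
  exists_add : ∀ X : g, ∃ Y ∈ N, ∃ Z ∈ L, ∃ W ∈ N, X = Y + Z + θ W

namespace IsShortDecomposition

variable {θ : g ≃ₗ⁅ℝ⁆ g} {L N : Submodule ℝ g}

/-- By invariance, `B([X, Y], θ [X, Y]) = B(X, [Y, θ [X, Y]])`; the second argument lies in `L`,
which is orthogonal to `N`. Definiteness does the rest. -/
lemma lie_nil_eq_zero (h : IsShortDecomposition θ L N) (hθ : IsCartanInvolution θ)
    {X Y : g} (hX : X ∈ N) (hY : Y ∈ N) : ⁅X, Y⁆ = 0 := by
  apply hθ.eq_zero_of_killingForm_apply_self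
  rw [killingForm_lie_left]
  exact h.killing_nil_levi _ hX _ (h.lie_nil_opp _ hY _ (h.lie_nil_nil _ hX _ hY))

/-- If `g` has no nontrivial ideals, then `N` has no nontrivial `L`-stable subspaces. -/
lemma eq_bot_or_eq [FiniteDimensional ℝ g] (h : IsShortDecomposition θ L N) (hθ : IsCartanInvolution θ)
    (hg : ∀ I : LieIdeal ℝ g, I = ⊥ ∨ I = ⊤) {V : Submodule ℝ g} (hVN : V ≤ N)
    (hV : ∀ X ∈ L, ∀ Y ∈ V, ⁅X, Y⁆ ∈ V) : V = ⊥ ∨ V = N := by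
  let W : Submodule ℝ g :=
    { carrier := {w | w ∈ N ∧ ∀ v ∈ V, killingForm ℝ g v (θ w) = 0}
      add_mem' := fun hx hy => ⟨add_mem hx.1 hy.1, fun v hv => by
        rw [map_add, map_add, hx.2 v hv, hy.2 v hv, add_zero]⟩
      zero_mem' := ⟨zero_mem _, by simp⟩
      smul_mem' := fun c x hx => ⟨N.smul_mem c hx.1, fun v hv => by
        rw [map_smul, map_smul, hx.2 v hv, smul_zero]⟩ }
  have hθθ := hθ.involutive
  have hWL : ∀ X ∈ L, ∀ w ∈ W, ⁅X, w⁆ ∈ W := by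
    refine fun X hX w hw => ⟨h.lie_levi_nil X hX w hw.1, fun v hv => ?_⟩
    rw [LieEquiv.map_lie, ← killingForm_lie_left, ← lie_skew, map_neg, LinearMap.neg_apply,
      hw.2 _ (hV _ (h.apply_mem X hX) v hv), neg_zero]
  -- With `Z = [v, θ w] ∈ L`, invariance gives `B(θ Z, Z) = B([θ Z, v], θ w)`, which is zero because
  -- `[θ Z, v] ∈ V`.
  have hVW : ∀ v ∈ V, ∀ w ∈ W, ⁅v, θ w⁆ = 0 := by
    intro v hv w hw
    have hZ : ⁅v, θ w⁆ ∈ L := h.lie_nil_opp v (hVN hv) w hw.1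
    apply hθ.eq_zero_of_killingForm_apply_self
    rw [killingForm_symm, ← killingForm_lie_left]
    exact hw.2 _ (hV _ (h.apply_mem _ hZ) v hv)
  have hWV : ∀ w ∈ W, ∀ v ∈ V, ⁅w, θ v⁆ = 0 := by
    intro w hw v hv
    have := congrArg θ (hVW v hv w hw)
    rw [LieEquiv.map_lie, hθθ, map_zero] at this
    rw [← lie_skew, this, neg_zero]
  have hNN : ∀ X ∈ N, ∀ Y ∈ N, ⁅X, Y⁆ = 0 := fun X hX Y hY => h.lie_nil_eq_zero hθ hX hY
  have hNVW : ∀ X ∈ N, ∃ v ∈ V, ∃ w ∈ W, X = v + w := by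
    intro X hX
    obtain ⟨v, hv, hv'⟩ := hθ.exists_sub_orthogonal V X
    exact ⟨v, hv, X - v, ⟨sub_mem hX (hVN hv), hv'⟩, by abel⟩
  let K : Submodule ℝ g :=
    { carrier := {Z | Z ∈ L ∧ ∀ w ∈ W, ⁅Z, w⁆ = 0 ∧ ⁅Z, θ w⁆ = 0}
      add_mem' := fun hx hy => ⟨add_mem hx.1 hy.1, fun w hw => by
        rw [add_lie, add_lie, (hx.2 w hw).1, (hx.2 w hw).2, (hy.2 w hw).1, (hy.2 w hw).2]
        simp⟩
      zero_mem' := ⟨zero_mem _, by simp⟩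
      smul_mem' := fun c x hx => ⟨L.smul_mem c hx.1, fun w hw => by
        rw [smul_lie, smul_lie, (hx.2 w hw).1, (hx.2 w hw).2]
        simp⟩ }
  -- By the Jacobi identity, every term contains a bracket of `V` with `θ W`, of `W` with `θ V`, or
  -- of two elements of `N` or of `θ N`; all of these vanish.
  have hVV : ∀ v ∈ V, ∀ v' ∈ V, ⁅v, θ v'⁆ ∈ K := by
    refine fun v hv v' hv' => ⟨h.lie_nil_opp v (hVN hv) v' (hVN hv'), fun w hw => ⟨?_, ?_⟩⟩
    · rw [lie_lie, ← lie_skew (θ v') w, hWV w hw v' hv', hNN v (hVN hv) w hw.1]; simp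
    · rw [lie_lie, hVW v hv w hw, ← LieEquiv.map_lie, hNN v' (hVN hv') w hw.1]; simp
  have hKθ : ∀ Z ∈ K, θ Z ∈ K := by
    refine fun Z hZ => ⟨h.apply_mem Z hZ.1, fun w hw => ⟨?_, ?_⟩⟩
    · rw [← hθθ w, ← LieEquiv.map_lie, (hZ.2 w hw).2, map_zero]
    · rw [← LieEquiv.map_lie, (hZ.2 w hw).1, map_zero]
  have hLK : ∀ X ∈ L, ∀ Z ∈ K, ⁅X, Z⁆ ∈ K := by
    refine fun X hX Z hZ => ⟨h.lie_levi_levi X hX Z hZ.1, fun w hw => ⟨?_, ?_⟩⟩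
    · rw [lie_lie, (hZ.2 w hw).1, (hZ.2 _ (hWL X hX w hw)).1]; simp
    · have := (hZ.2 _ (hWL _ (h.apply_mem X hX) w hw)).2
      rw [LieEquiv.map_lie, hθθ] at this
      rw [lie_lie, (hZ.2 w hw).2, this]; simp
  let I' : Submodule ℝ g :=
    { carrier := {X | ∃ v ∈ V, ∃ Z ∈ K, ∃ v' ∈ V, X = v + Z + θ v'}
      add_mem' := by
        rintro _ _ ⟨v, hv, Z, hZ, v', hv', rfl⟩ ⟨u, hu, Y, hY, u', hu', rfl⟩
        exact ⟨v + u, add_mem hv hu, Z + Y, add_mem hZ hY, v' + u', add_mem hv' hu', by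
          rw [map_add]; abel⟩
      zero_mem' := ⟨0, zero_mem _, 0, zero_mem _, 0, zero_mem _, by simp⟩
      smul_mem' := by
        rintro c _ ⟨v, hv, Z, hZ, v', hv', rfl⟩
        exact ⟨c • v, V.smul_mem c hv, c • Z, K.smul_mem c hZ, c • v', V.smul_mem c hv', by
          rw [map_smul, smul_add, smul_add]⟩ }
  have hVI : ∀ v ∈ V, v ∈ I' := fun v hv => ⟨v, hv, 0, zero_mem _, 0, zero_mem _, by simp⟩
  have hKI : ∀ Z ∈ K, Z ∈ I' := fun Z hZ => ⟨0, zero_mem _, Z, hZ, 0, zero_mem _, by simp⟩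
  have hθI : ∀ X ∈ I', θ X ∈ I' := by
    rintro _ ⟨v, hv, Z, hZ, v', hv', rfl⟩
    exact ⟨v', hv', θ Z, hKθ Z hZ, v, hv, by rw [map_add, map_add, hθθ]; abel⟩
  have hNI : ∀ X ∈ N, ∀ Y ∈ I', ⁅X, Y⁆ ∈ I' := by
    rintro X hX _ ⟨v, hv, Z, hZ, v', hv', rfl⟩
    obtain ⟨u, hu, w, hw, rfl⟩ := hNVW X hX
    rw [lie_add, lie_add, hNN _ hX v (hVN hv), zero_add, add_lie, add_lie, hWV w hw v' hv',
      add_zero, ← lie_skew w Z, (hZ.2 w hw).1, neg_zero, add_zero, ← lie_skew u Z]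
    exact add_mem (neg_mem (hVI _ (hV Z hZ.1 u hu))) (hKI _ (hVV u hu v' hv'))
  have hLI : ∀ X ∈ L, ∀ Y ∈ I', ⁅X, Y⁆ ∈ I' := by
    rintro X hX _ ⟨v, hv, Z, hZ, v', hv', rfl⟩
    have : ⁅X, θ v'⁆ = θ ⁅θ X, v'⁆ := by rw [LieEquiv.map_lie, hθθ]
    rw [lie_add, lie_add, this]
    exact ⟨_, hV X hX v hv, _, hLK X hX Z hZ, _, hV _ (h.apply_mem X hX) v' hv', rfl⟩
  let I : LieIdeal ℝ g :=
    { I' with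
      lie_mem := by
        intro X Y hY
        change Y ∈ I' at hY
        change ⁅X, Y⁆ ∈ I'
        obtain ⟨n, hn, l, hl, n', hn', rfl⟩ := h.exists_add X
        -- Since `I'` is `θ`-stable, brackets with `θ N` reduce to brackets with `N`.
        have : ⁅θ n', Y⁆ = θ ⁅n', θ Y⁆ := by rw [LieEquiv.map_lie, hθθ]
        rw [add_lie, add_lie, this]
        exact add_mem (add_mem (hNI n hn Y hY) (hLI l hl Y hY))
          (hθI _ (hNI n' hn' _ (hθI Y hY))) }
  rcases hg I with hI | hI
  · left
    rw [eq_bot_iff]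
    intro v hv
    have : v ∈ I := hVI v hv
    rwa [hI] at this
  · right
    refine le_antisymm hVN fun X hX => ?_
    obtain ⟨v, hv, w, hw, rfl⟩ := hNVW X hX
    suffices w = 0 by rwa [this, add_zero]
    -- Expanding `w` in `V + K + θ V`, each of the three parts is orthogonal to `w`, so `w` has norm
    -- zero.
    obtain ⟨u, hu, Z, hZ, u', hu', hw'⟩ : w ∈ I' := by
      change w ∈ I
      rw [hI]; trivial
    apply hθ.eq_zero_of_killingForm_apply_self
    have h3 : killingForm ℝ g (θ u') (θ w) = 0 := by
      rw [LieAlgebra.killingForm_of_equiv_apply]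
      exact h.killing_nil_nil _ (hVN hu') _ hw.1
    have h2 : killingForm ℝ g Z (θ w) = 0 := by
      rw [← hθ.killingForm_apply_left, killingForm_symm]
      exact h.killing_nil_levi _ hw.1 _ (h.apply_mem Z hZ.1)
    conv_lhs => rw [show killingForm ℝ g w = killingForm ℝ g (u + Z + θ u') from congrArg _ hw']
    rw [map_add, map_add, LinearMap.add_apply, LinearMap.add_apply, hw.2 u hu, h2, h3]
    simp

end IsShortDecomposition

end IrreducibleNilradical

/-! ### Arithmetic of levels. -/

section Levels

variable {V : Type*} [AddCommGroup V] {Δ Θ : Set V}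

lemma HasLevel.neg {lam : V} {k : ℤ} (h : HasLevel Δ Θ lam k) : HasLevel Δ Θ (-lam) (-k) := by
  classical
  obtain ⟨c, ⟨hc, rfl⟩, rfl⟩ := h
  refine ⟨-c, ⟨by rwa [Finsupp.support_neg], ?_⟩, ?_⟩
  · rw [Finsupp.sum_neg_index] <;> simp [Finsupp.sum]
  · rw [Finsupp.sum_neg_index]
    · rw [Finsupp.sum, Finsupp.sum, ← Finset.sum_neg_distrib]
      refine Finset.sum_congr rfl fun α _ => ?_
      split_ifs <;> simp
    · simp

lemma HasLevel.unique [Module ℝ V] (hΔ : LinearIndepOn ℝ id Δ) {lam : V} {k l : ℤ}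
    (h : HasLevel Δ Θ lam k) (h' : HasLevel Δ Θ lam l) : k = l := by
  obtain ⟨c, hc, rfl⟩ := h
  obtain ⟨d, hd, rfl⟩ := h'
  rw [hc.unique hΔ hd]

lemma HasLevel.of_mem_diff {lam : V} (h : lam ∈ Δ) (h' : lam ∉ Θ) : HasLevel Δ Θ lam 1 := by
  classical
  refine ⟨Finsupp.single lam 1, ⟨?_, by simp⟩, by simp [h']⟩
  intro x hx
  have := Finsupp.support_single_subset hx
  rw [Finset.mem_singleton] at this
  rwa [this]

end Levels

/-! ### Standard parabolic subalgebras: the grading, the dilatation algebra and the Lorentz algebra.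
-/

namespace StandardParabolic

variable {g : Type*} [LieRing g] [LieAlgebra ℝ g] (P : StandardParabolic g)

/-- Invariance under `ad A` gives `(lam + mu)(A) B(X, Y) = 0` for every `A`. -/
lemma killingForm_restrictedRootSpace {a : Submodule ℝ g} {lam mu : Module.Dual ℝ a}
    (h : lam + mu ≠ 0) {X Y : g} (hX : X ∈ restrictedRootSpace a lam)
    (hY : Y ∈ restrictedRootSpace a mu) : killingForm ℝ g X Y = 0 := by
  obtain ⟨A, hA⟩ : ∃ A, (lam + mu) A ≠ 0 := by
    by_contra! h'
    exact h (LinearMap.ext h')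
  have h1 := killingForm_lie_left X (A : g) Y
  rw [← lie_skew, hX A, hY A, map_neg, LinearMap.neg_apply, map_smul, map_smul,
    LinearMap.smul_apply, smul_eq_mul, smul_eq_mul] at h1
  have h2 : (lam + mu) A * killingForm ℝ g X Y = 0 := by
    rw [LinearMap.add_apply]; linarith
  exact (mul_eq_zero.1 h2).resolve_left hA

lemma mem_piece {k : ℤ} {lam : Module.Dual ℝ P.a} (hk : HasLevel P.simple P.Θ lam k)
    (h : lam = 0 ∨ lam ∈ restrictedRoots P.a) {X : g} (hX : X ∈ restrictedRootSpace P.a lam) :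
    X ∈ P.piece k :=
  Submodule.mem_iSup_of_mem lam (Submodule.mem_iSup_of_mem ⟨h, hk⟩ hX)

variable {P} in
/-- To prove a property of the elements of a graded piece, it suffices to treat root vectors. -/
lemma piece_induction {k : ℤ} {p : (X : g) → X ∈ P.piece k → Prop}
    (mem : ∀ lam (h : lam = 0 ∨ lam ∈ restrictedRoots P.a) (hk : HasLevel P.simple P.Θ lam k)
      X (hX : X ∈ restrictedRootSpace P.a lam), p X (P.mem_piece hk h hX))
    (zero : p 0 (zero_mem _))
    (add : ∀ X Y hX hY, p X hX → p Y hY → p (X + Y) (add_mem hX hY)) {X : g}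
    (hX : X ∈ P.piece k) : p X hX := by
  -- The motive depends on the membership proof, so the induction carries that proof along
  -- existentially.
  suffices ∃ h, p X h from this.2
  have hX' := hX
  unfold piece gradedPiece at hX'
  rw [iSup_subtype'] at hX'
  induction hX' using Submodule.iSup_induction' with
  | zero => exact ⟨_, zero⟩
  | add X₁ X₂ h₁' h₂' h₁ h₂ =>
    rw [← iSup_subtype' (f := fun lam _ => restrictedRootSpace P.a lam)] at h₁' h₂'
    exact ⟨_, add _ _ _ _ (h₁ h₁').2 (h₂ h₂').2⟩
  | mem lam Y hY => exact ⟨_, mem lam lam.2.1 lam.2.2 Y hY⟩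

/-- Root spaces pair nontrivially only for opposite functionals, and these have opposite levels
because levels are unique. -/
lemma killingForm_piece {k l : ℤ} (h : k + l ≠ 0) {X Y : g} (hX : X ∈ P.piece k)
    (hY : Y ∈ P.piece l) : killingForm ℝ g X Y = 0 := by
  induction hX using piece_induction with
  | zero => simp
  | add X₁ X₂ _ _ h₁ h₂ => rw [map_add, LinearMap.add_apply, h₁, h₂, add_zero]
  | mem lam _ hk X hX =>
    induction hY using piece_induction with
    | zero => simp
    | add X₁ X₂ _ _ h₁ h₂ => rw [map_add, h₁, h₂, add_zero]
    | mem mu _ hl Y hY =>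
      refine killingForm_restrictedRootSpace (fun h0 => h ?_) hX hY
      have := hk.add hl
      rw [h0] at this
      exact this.unique P.isSimpleSystem.linearIndep (HasLevel.zero _ _)

lemma neg_mem_restrictedRoots {lam : Module.Dual ℝ P.a} (h : lam ∈ restrictedRoots P.a) :
    -lam ∈ restrictedRoots P.a := by
  refine ⟨neg_ne_zero.2 h.1, fun h0 => ?_⟩
  obtain ⟨X, hX, hX0⟩ := Submodule.exists_mem_ne_zero_of_ne_bot h.2
  have := P.θ.apply_mem_restrictedRootSpace P.isMaximalCommuting.prop.1 hX
  rw [h0, Submodule.mem_bot] at this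
  exact hX0 (P.θ.injective (this.trans (map_zero P.θ).symm))

lemma apply_mem_piece {k : ℤ} {X : g} (hX : X ∈ P.piece k) : P.θ X ∈ P.piece (-k) := by
  induction hX using piece_induction with
  | zero => simp
  | add X₁ X₂ _ _ h₁ h₂ => rw [map_add]; exact add_mem h₁ h₂
  | mem lam h hk X hX =>
    refine P.mem_piece hk.neg ?_
      (P.θ.apply_mem_restrictedRootSpace P.isMaximalCommuting.prop.1 hX)
    rcases h with rfl | h
    · simp
    · exact Or.inr (P.neg_mem_restrictedRoots h)

lemma mem_nilPlus_of_mem_piece {k : ℤ} (hk : 0 < k) {X : g} (hX : X ∈ P.piece k) :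
    X ∈ P.nilPlus :=
  Submodule.mem_iSup_of_mem (p := fun k : {k : ℤ // 0 < k} => P.piece k) ⟨k, hk⟩ hX

variable {P} in
lemma nilPlus_induction {p : (X : g) → X ∈ P.nilPlus → Prop}
    (mem : ∀ (k : ℤ) (hk : 0 < k) X (hX : X ∈ P.piece k), p X (P.mem_nilPlus_of_mem_piece hk hX))
    (zero : p 0 (zero_mem _))
    (add : ∀ X Y hX hY, p X hX → p Y hY → p (X + Y) (add_mem hX hY)) {X : g}
    (hX : X ∈ P.nilPlus) : p X hX := by
  change X ∈ ⨆ k : {k : ℤ // 0 < k}, P.piece k at hX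
  induction hX using Submodule.iSup_induction' with
  | zero => exact zero
  | add X₁ X₂ _ _ h₁ h₂ => exact add _ _ _ _ h₁ h₂
  | mem k X hX => exact mem k k.2 X hX

lemma apply_mem_nilMinus {X : g} (hX : X ∈ P.nilPlus) : P.θ X ∈ P.nilMinus := by
  induction hX using nilPlus_induction with
  | zero => simp
  | add X₁ X₂ _ _ h₁ h₂ => rw [map_add]; exact add_mem h₁ h₂
  | mem k hk X hX =>
    exact Submodule.mem_iSup_of_mem (p := fun k : {k : ℤ // k < 0} => P.piece k)
      ⟨-k, by omega⟩ (P.apply_mem_piece hX)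

lemma lie_levi_nilPlus {X Y : g} (hX : X ∈ P.piece 0) (hY : Y ∈ P.nilPlus) :
    ⁅X, Y⁆ ∈ P.nilPlus := by
  induction hY using nilPlus_induction with
  | zero => simp
  | add X₁ X₂ _ _ h₁ h₂ => rw [lie_add]; exact add_mem h₁ h₂
  | mem k hk Y hY => exact P.mem_nilPlus_of_mem_piece (by omega) (lie_mem_gradedPiece hX hY)

lemma lie_nilPlus_nilPlus {X Y : g} (hX : X ∈ P.nilPlus) (hY : Y ∈ P.nilPlus) :
    ⁅X, Y⁆ ∈ P.nilPlus := by
  induction hX using nilPlus_induction with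
  | zero => simp
  | add X₁ X₂ _ _ h₁ h₂ => rw [add_lie]; exact add_mem h₁ h₂
  | mem k hk X hX =>
    induction hY using nilPlus_induction with
    | zero => simp
    | add X₁ X₂ _ _ h₁ h₂ => rw [lie_add]; exact add_mem h₁ h₂
    | mem l hl Y hY => exact P.mem_nilPlus_of_mem_piece (by omega) (lie_mem_gradedPiece hX hY)

lemma killingForm_nilPlus_piece {l : ℤ} (hl : 0 ≤ l) {X Y : g} (hX : X ∈ P.nilPlus)
    (hY : Y ∈ P.piece l) : killingForm ℝ g X Y = 0 := by
  induction hX using nilPlus_induction with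
  | zero => simp
  | add X₁ X₂ _ _ h₁ h₂ => rw [map_add, LinearMap.add_apply, h₁, h₂, add_zero]
  | mem k hk X hX => exact P.killingForm_piece (by omega) hX hY

lemma killingForm_nilPlus_nilPlus {X Y : g} (hX : X ∈ P.nilPlus) (hY : Y ∈ P.nilPlus) :
    killingForm ℝ g X Y = 0 := by
  induction hY using nilPlus_induction with
  | zero => simp
  | add X₁ X₂ _ _ h₁ h₂ => rw [map_add, h₁, h₂, add_zero]
  | mem k hk Y hY => exact P.killingForm_nilPlus_piece hk.le hX hY

lemma exists_hasLevel {lam : Module.Dual ℝ P.a} (h : lam = 0 ∨ lam ∈ restrictedRoots P.a) :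
    ∃ k, HasLevel P.simple P.Θ lam k := by
  rcases h with rfl | h
  · exact ⟨0, HasLevel.zero _ _⟩
  · obtain ⟨c, hc, -⟩ := P.isSimpleSystem.expansion lam h
    exact ⟨_, c, hc, rfl⟩

lemma exists_eq_nilPlus_add_levi_add [FiniteDimensional ℝ g] (X : g) :
    ∃ Y ∈ P.nilPlus, ∃ Z ∈ P.piece 0, ∃ W ∈ P.nilPlus, X = Y + Z + P.θ W := by
  have hX : X ∈ ⨆ lam : Module.Dual ℝ P.a, restrictedRootSpace P.a lam := by
    rw [P.isCartanInvolution.iSup_restrictedRootSpace P.isMaximalCommuting.prop.1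
      P.isMaximalCommuting.prop.2]
    trivial
  induction hX using Submodule.iSup_induction' with
  | zero => exact ⟨0, zero_mem _, 0, zero_mem _, 0, zero_mem _, by simp⟩
  | add X₁ X₂ _ _ h₁ h₂ =>
    obtain ⟨Y, hY, Z, hZ, W, hW, rfl⟩ := h₁
    obtain ⟨Y', hY', Z', hZ', W', hW', rfl⟩ := h₂
    exact ⟨Y + Y', add_mem hY hY', Z + Z', add_mem hZ hZ', W + W', add_mem hW hW', by
      rw [map_add]; abel⟩
  | mem lam X hX =>
    by_cases hX0 : X = 0
    · exact ⟨0, zero_mem _, 0, zero_mem _, 0, zero_mem _, by simp [hX0]⟩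
    have hlam : lam = 0 ∨ lam ∈ restrictedRoots P.a := by
      by_cases h0 : lam = 0
      · exact Or.inl h0
      · exact Or.inr ⟨h0, (Submodule.ne_bot_iff _).2 ⟨X, hX, hX0⟩⟩
    obtain ⟨k, hk⟩ := P.exists_hasLevel hlam
    have hXk := P.mem_piece hk hlam hX
    rcases lt_trichotomy k 0 with h | rfl | h
    -- A vector of negative level is `θ` of the vector `θ X` of positive level.
    · exact ⟨0, zero_mem _, 0, zero_mem _, P.θ X,
        P.mem_nilPlus_of_mem_piece (by omega) (P.apply_mem_piece hXk), by
          rw [P.isCartanInvolution.involutive]; simp⟩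
    · exact ⟨0, zero_mem _, X, hXk, 0, zero_mem _, by simp⟩
    · exact ⟨X, P.mem_nilPlus_of_mem_piece h hXk, 0, zero_mem _, 0, zero_mem _, by simp⟩

/-- The hypothesis `hlevi` supplies `lie_nil_opp`; the other fields come from the grading and its
symmetry under `θ`. -/
lemma isShortDecomposition [FiniteDimensional ℝ g]
    (hlevi : ∀ X ∈ P.nilPlus, ∀ Y ∈ P.nilMinus, ⁅X, Y⁆ ∈ P.levi) :
    IsShortDecomposition P.θ (P.piece 0) P.nilPlus.toSubmodule where
  apply_mem X hX := by simpa using P.apply_mem_piece hX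
  lie_levi_levi X hX Y hY := P.levi.lie_mem hX hY
  lie_levi_nil X hX Y hY := P.lie_levi_nilPlus hX hY
  lie_nil_nil X hX Y hY := P.lie_nilPlus_nilPlus hX hY
  lie_nil_opp X hX Y hY := hlevi X hX _ (P.apply_mem_nilMinus hY)
  killing_nil_levi X hX Y hY := P.killingForm_nilPlus_piece le_rfl hX hY
  killing_nil_nil X hX Y hY := P.killingForm_nilPlus_nilPlus hX hY
  exists_add X := P.exists_eq_nilPlus_add_levi_add X

/-- Properness of `Θ` makes the nilradical nonzero: a simple root outside `Θ` has level one. -/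
lemma exists_root_vector_mem_nilPlus :
    ∃ lam : Module.Dual ℝ P.a, ∃ X ∈ restrictedRootSpace P.a lam, X ∈ P.nilPlus ∧ X ≠ 0 := by
  obtain ⟨lam, hlam, hlam'⟩ := Set.exists_of_ssubset P.ssubset
  have hroot := P.isSimpleSystem.subset hlam
  obtain ⟨X, hX, hX0⟩ := Submodule.exists_mem_ne_zero_of_ne_bot hroot.2
  exact ⟨lam, X, hX, P.mem_nilPlus_of_mem_piece one_pos
    (P.mem_piece (HasLevel.of_mem_diff hlam hlam') (Or.inr hroot) hX), hX0⟩

/-- The dilatation algebra acts on the nilradical by scalars. -/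
lemma exists_dilatation_scalar [FiniteDimensional ℝ g]
    (hg : ∀ I : LieIdeal ℝ g, I = ⊥ ∨ I = ⊤)
    (hlevi : ∀ X ∈ P.nilPlus, ∀ Y ∈ P.nilMinus, ⁅X, Y⁆ ∈ P.levi) {A : g}
    (hA : A ∈ P.dilatation) : ∃ c : ℝ, ∀ X ∈ P.nilPlus, ⁅A, X⁆ = c • X := by
  obtain ⟨hAa, -⟩ := mem_commonKernel.1 hA
  obtain ⟨lam, X, hX, hXN, hX0⟩ := P.exists_root_vector_mem_nilPlus
  refine ⟨lam ⟨A, hAa⟩, ?_⟩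
  -- This eigenspace is `L`-stable because `A` centralizes level zero, and it contains the root
  -- vector `X`.
  let V : Submodule ℝ g :=
    P.nilPlus.toSubmodule ⊓ Module.End.eigenspace (LieAlgebra.ad ℝ g A) (lam ⟨A, hAa⟩)
  have hVmem : ∀ Y, Y ∈ V ↔ Y ∈ P.nilPlus ∧ ⁅A, Y⁆ = lam ⟨A, hAa⟩ • Y := by
    intro Y
    rw [Submodule.mem_inf, Module.End.mem_eigenspace_iff]
    rfl
  have hV := (P.isShortDecomposition hlevi).eq_bot_or_eq P.isCartanInvolution hg
    (V := V) inf_le_left (fun Z hZ Y hY => by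
      rw [hVmem] at hY ⊢
      refine ⟨P.lie_levi_nilPlus hZ hY.1, ?_⟩
      rw [leibniz_lie, lie_commonKernel_eq_zero P.isSimpleSystem hA hZ, zero_lie, zero_add, hY.2,
        lie_smul])
  have hXV : X ∈ V := (hVmem X).2 ⟨hXN, hX ⟨A, hAa⟩⟩
  rcases hV with hV | hV
  · rw [hV, Submodule.mem_bot] at hXV
    exact absurd hXV hX0
  · intro Y hY
    have : Y ∈ V := by rw [hV]; exact hY
    exact ((hVmem Y).1 this).2

lemma dilatation_le_levi {A : g} (hA : A ∈ P.dilatation) : A ∈ P.piece 0 := by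
  obtain ⟨hAa, -⟩ := mem_commonKernel.1 hA
  refine P.mem_piece (HasLevel.zero _ _) (Or.inl rfl) fun A' => ?_
  rw [P.isMaximalCommuting.prop.2 _ A'.2 _ hAa]
  simp

/-- The Levi subalgebra is the sum of the dilatation algebra and the Lorentz algebra. -/
lemma exists_dilatation_add_lorentz [FiniteDimensional ℝ g] {X : g} (hX : X ∈ P.piece 0) :
    ∃ A ∈ P.dilatation, ∃ M ∈ P.lorentz, X = A + M := by
  obtain ⟨A, hA, h⟩ := P.isCartanInvolution.exists_sub_orthogonal P.dilatation.toSubmodule X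
  refine ⟨A, hA, X - A, ⟨sub_mem hX (P.dilatation_le_levi hA), fun A' hA' => ?_⟩, by abel⟩
  obtain ⟨hAa, -⟩ := mem_commonKernel.1 hA'
  -- As `θ = -1` on `a`, orthogonality for the inner product is the same as orthogonality for `B`
  -- here.
  have hθ : P.θ A' = -A' := P.isMaximalCommuting.prop.1 hAa
  have := h A' hA'
  rw [← P.isCartanInvolution.killingForm_apply_left, hθ, map_neg, LinearMap.neg_apply,
    neg_eq_zero] at this
  exact this

lemma isIrreducible_nilPlus [FiniteDimensional ℝ g]
    (hg : ∀ I : LieIdeal ℝ g, I = ⊥ ∨ I = ⊤)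
    (hlevi : ∀ X ∈ P.nilPlus, ∀ Y ∈ P.nilMinus, ⁅X, Y⁆ ∈ P.levi) :
    LieModule.IsIrreducible ℝ P.lorentz P.nilPlus := by
  obtain ⟨-, X, -, hXN, hX0⟩ := P.exists_root_vector_mem_nilPlus
  have : Nontrivial P.nilPlus := ⟨⟨X, hXN⟩, 0, fun h => hX0 (congrArg Subtype.val h)⟩
  refine LieModule.IsIrreducible.mk fun U hU => ?_
  let V : Submodule ℝ g := U.toSubmodule.map P.nilPlus.toSubmodule.subtype
  have hVmem : ∀ (Y : g) (hY : Y ∈ P.nilPlus), Y ∈ V ↔ (⟨Y, hY⟩ : P.nilPlus) ∈ U := by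
    intro Y hY
    constructor
    · rintro ⟨Z, hZ, rfl⟩; exact hZ
    · exact fun h => ⟨_, h, rfl⟩
  have hVN : V ≤ P.nilPlus.toSubmodule := Submodule.map_subtype_le _ _
  have hV := (P.isShortDecomposition hlevi).eq_bot_or_eq P.isCartanInvolution hg hVN
    (fun Z hZ Y hY => by
      -- The dilatation part of `Z` acts by a scalar, so only the Lorentz part has to preserve `V`.
      obtain ⟨A, hA, M, hM, rfl⟩ := P.exists_dilatation_add_lorentz hZ
      obtain ⟨c, hc⟩ := P.exists_dilatation_scalar hg hlevi hA
      rw [add_lie, hc Y (hVN hY)]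
      refine add_mem (V.smul_mem c hY) ?_
      have hYU := (hVmem Y (hVN hY)).1 hY
      exact ⟨_, U.lie_mem (x := ⟨M, hM⟩) hYU, rfl⟩)
  rcases hV with hV | hV
  · refine absurd ?_ hU
    rw [LieSubmodule.eq_bot_iff]
    rintro ⟨Y, hY⟩ hYU
    have := (hVmem Y hY).2 hYU
    rw [hV, Submodule.mem_bot] at this
    exact Subtype.ext this
  · rw [eq_top_iff]
    rintro ⟨Y, hY⟩ -
    exact (hVmem Y hY).1 (by rw [hV]; exact hY)

end StandardParabolic

/-! ### Descent of simplicity from the complexification. -/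

/-- A real Lie algebra with simple complexification has no nontrivial ideals. -/
lemma LieIdeal.eq_bot_or_eq_top_of_isSimple_complexification {g : Type*} [LieRing g]
    [LieAlgebra ℝ g] (h : LieAlgebra.IsSimple ℂ (ℂ ⊗[ℝ] g)) (I : LieIdeal ℝ g) :
    I = ⊥ ∨ I = ⊤ := by
  -- The complexified ideal dies in the complexified quotient, and `g ⧸ I` embeds in its
  -- complexification by faithful flatness.
  have key : ∀ X : g, (1 : ℂ) ⊗ₜ[ℝ] X ∈ I.baseChange ℂ → X ∈ I := by
    intro X hX
    have hle : I.toSubmodule.baseChange ℂ ≤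
        LinearMap.ker (I.toSubmodule.mkQ.baseChange ℂ) := by
      rw [Submodule.baseChange, LinearMap.range_le_ker_iff, ← LinearMap.baseChange_comp,
        show I.toSubmodule.mkQ ∘ₗ I.toSubmodule.subtype = 0 by ext; simp, LinearMap.baseChange_zero]
    have h1 : (1 : ℂ) ⊗ₜ[ℝ] I.toSubmodule.mkQ X = 0 := hle hX
    have h2 : I.toSubmodule.mkQ X = 0 :=
      Module.FaithfullyFlat.tensorProduct_mk_injective (A := ℝ) (B := ℂ) (g ⧸ I.toSubmodule)
        (by simpa using h1)
    exact (Submodule.Quotient.mk_eq_zero _).1 h2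
  rcases h.eq_bot_or_eq_top (I.baseChange ℂ) with h | h
  · left
    rw [LieSubmodule.eq_bot_iff]
    intro X hX
    have hX' : (1 : ℂ) ⊗ₜ[ℝ] X ∈ I.baseChange ℂ :=
      LieSubmodule.tmul_mem_baseChange_of_mem 1 hX
    rw [h, LieSubmodule.mem_bot] at hX'
    exact Module.FaithfullyFlat.tensorProduct_mk_injective (A := ℝ) (B := ℂ) g
      (by simpa using hX')
  · right
    rw [eq_top_iff]
    intro X _
    exact key X (by rw [h]; trivial)

/-! ### Second-order calculus of a local group law. -/

section LocalGroupLaw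

open Filter Topology

variable {E : Type*} [NormedAddCommGroup E] [NormedSpace ℝ E]

/-- For a local group law `m` with unit `e`, the derivative of conjugation along a curve with
velocity `A` is the Lie bracket of the left-invariant vector fields. -/
lemma hasDerivAt_fderiv_conj {m : E × E → E} {e : E} (hm : ContDiffAt ℝ 2 m (e, e))
    (hl : ∀ᶠ v in 𝓝 e, m (e, v) = v) (hr : ∀ᶠ u in 𝓝 e, m (u, e) = u)
    {p q : ℝ → E} {A : E} (hp : HasDerivAt p A 0) (hq : HasDerivAt q (-A) 0)
    (hp0 : p 0 = e) (hq0 : q 0 = e) (X : E) :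
    HasDerivAt (fun t => fderiv ℝ (fun v => m (m (p t, v), q t)) e X)
      (VectorField.lieBracket ℝ (fun u => fderiv ℝ m (u, e) (0, A))
        (fun u => fderiv ℝ m (u, e) (0, X)) e) 0 := by
  set D := fderiv ℝ m with hD
  have hD1 : ContDiffAt ℝ 1 D (e, e) := hm.fderiv_right (by norm_num)
  set D2 := fderiv ℝ D (e, e)
  have hD2 : HasFDerivAt D D2 (e, e) := (hD1.differentiableAt one_ne_zero).hasFDerivAt
  have hdiff : ∀ᶠ z in 𝓝 (e, e), DifferentiableAt ℝ m z :=
    (hm.eventually (by simp)).mono fun z hz => hz.differentiableAt two_ne_zero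
  have hsymm : ∀ v w, D2 v w = D2 w v := hm.isSymmSndFDerivAt (by simp)
  have hiu : HasFDerivAt (fun u : E => (u, e)) (ContinuousLinearMap.inl ℝ E E) e :=
    hasFDerivAt_prodMk_left e e
  have hDr : ∀ᶠ u in 𝓝 e, ∀ w, D (u, e) (w, 0) = w := by
    have h1 : ∀ᶠ u in 𝓝 e, DifferentiableAt ℝ m (u, e) :=
      hiu.continuousAt.eventually hdiff
    filter_upwards [h1, hr.eventually_nhds] with u hu hru w
    have h2 : HasFDerivAt (fun u : E => m (u, e)) (D (u, e) ∘L ContinuousLinearMap.inl ℝ E E) u :=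
      hu.hasFDerivAt.comp u (hasFDerivAt_prodMk_left u e)
    have h3 : HasFDerivAt (fun u : E => m (u, e)) (ContinuousLinearMap.id ℝ E) u :=
      (hasFDerivAt_id u).congr_of_eventuallyEq hru
    simpa using congrArg (fun L => L w) (h2.unique h3)
  have hfield : ∀ Y : E, HasFDerivAt (fun u => D (u, e) (0, Y))
      ((ContinuousLinearMap.apply ℝ E ((0, Y) : E × E)) ∘L D2 ∘L ContinuousLinearMap.inl ℝ E E)
      e := fun Y =>
    (ContinuousLinearMap.apply ℝ E ((0, Y) : E × E)).hasFDerivAt.comp e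
      (HasFDerivAt.comp e (f := fun u : E => (u, e)) hD2 hiu)
  have hDl : ∀ w, D (e, e) (0, w) = w := by
    intro w
    have h2 : HasFDerivAt (fun v : E => m (e, v))
        (D (e, e) ∘L ContinuousLinearMap.inr ℝ E E) e :=
      HasFDerivAt.comp e (f := fun v : E => (e, v)) hdiff.self_of_nhds.hasFDerivAt
        (hasFDerivAt_prodMk_right e e)
    have h3 : HasFDerivAt (fun v : E => m (e, v)) (ContinuousLinearMap.id ℝ E) e :=
      (hasFDerivAt_id e).congr_of_eventuallyEq hl
    simpa using congrArg (fun L => L w) (h2.unique h3)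
  -- The unit law makes `D (u, e) (w, 0) = w` constant in `u`, so its derivative vanishes.
  have hD20 : ∀ v w, D2 (v, 0) (w, 0) = 0 := by
    intro v w
    have h2 : HasFDerivAt (fun u => D (u, e) (w, 0))
        ((ContinuousLinearMap.apply ℝ E ((w, 0) : E × E)) ∘L D2 ∘L
          ContinuousLinearMap.inl ℝ E E) e :=
      (ContinuousLinearMap.apply ℝ E ((w, 0) : E × E)).hasFDerivAt.comp e
        (HasFDerivAt.comp e (f := fun u : E => (u, e)) hD2 hiu)
    have h3 : HasFDerivAt (fun u => D (u, e) (w, 0)) (0 : E →L[ℝ] E) e :=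
      (hasFDerivAt_const w e).congr_of_eventuallyEq (hDr.mono fun u hu => hu w)
    simpa using congrArg (fun L => L v) (h2.unique h3)
  have hpt : Tendsto p (𝓝 0) (𝓝 e) := by simpa [hp0] using hp.continuousAt.tendsto
  have hqt : Tendsto q (𝓝 0) (𝓝 e) := by simpa [hq0] using hq.continuousAt.tendsto
  have heq : (fun t => fderiv ℝ (fun v => m (m (p t, v), q t)) e X) =ᶠ[𝓝 0]
      fun t => D (p t, q t) (D (p t, e) (0, X), 0) := by
    have h1 : ∀ᶠ t in 𝓝 0, DifferentiableAt ℝ m (p t, q t) :=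
      (hpt.prodMk_nhds hqt).eventually hdiff
    have h2 : ∀ᶠ t in 𝓝 0, DifferentiableAt ℝ m (p t, e) :=
      (hpt.prodMk_nhds tendsto_const_nhds).eventually hdiff
    filter_upwards [h1, h2, hpt.eventually hr] with t h1 h2 h3
    have h4 : HasFDerivAt (fun v : E => m (p t, v))
        (D (p t, e) ∘L ContinuousLinearMap.inr ℝ E E) e :=
      HasFDerivAt.comp e (f := fun v : E => (p t, v)) h2.hasFDerivAt
        (hasFDerivAt_prodMk_right (p t) e)
    have h5 := h4.prodMk (hasFDerivAt_const (q t) e)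
    have h6 : HasFDerivAt m (D (p t, q t)) (m (p t, e), q t) := by
      rw [h3]; exact h1.hasFDerivAt
    have h7 := HasFDerivAt.comp e (f := fun v : E => (m (p t, v), q t)) h6 h5
    have h8 := h7.fderiv
    simp only [Function.comp_def] at h8
    rw [h8]
    simp
  refine HasDerivAt.congr_of_eventuallyEq ?_ heq
  have hpq : HasDerivAt (fun t => D (p t, q t)) (D2 (A, -A)) 0 := by
    have : HasFDerivAt D D2 (p 0, q 0) := by rwa [hp0, hq0]
    exact HasFDerivAt.comp_hasDerivAt (f := fun t => (p t, q t)) 0 this (hp.prodMk hq)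
  have hpX : HasDerivAt (fun t => D (p t, e) (0, X)) (D2 (A, 0) (0, X)) 0 := by
    have := hfield X
    rw [← hp0] at this
    simpa [hp0, Function.comp_def] using this.comp_hasDerivAt (f := p) 0 hp
  have hpX' := hpX.prodMk (hasDerivAt_const (0 : ℝ) (0 : E))
  convert hpq.clm_apply hpX' using 1
  rw [VectorField.lieBracket, (hfield A).fderiv, (hfield X).fderiv, hp0, hq0, hDl, hDl,
    hDr.self_of_nhds]
  -- Only the mixed second derivative survives; its symmetry turns it into the second term of the
  -- Lie bracket.
  have h9 : D2 (A, -A) (X, 0) = - D2 (X, 0) (0, A) := by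
    rw [show ((A, -A) : E × E) = (A, 0) - (0, A) by simp, map_sub, sub_apply,
      hD20, hsymm (0, A)]
    simp
  rw [h9]
  simp
  abel

end LocalGroupLaw

/-! ### The Lie bracket read in the chart at the identity. -/

section AdjointDerivative

open Filter Topology VectorField

variable {E : Type*} [NormedAddCommGroup E] [NormedSpace ℝ E]
  {H : Type*} [TopologicalSpace H] (I : ModelWithCorners ℝ E H)
  (G : Type*) [TopologicalSpace G] [ChartedSpace H G] [Group G]

/-- The multiplication of a Lie group read in the preferred chart at the identity. -/
noncomputable def chartMul (z : E × E) : E :=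
  extChartAt I (1 : G) ((extChartAt I (1 : G)).symm z.1 * (extChartAt I (1 : G)).symm z.2)

variable [I.Boundaryless]

lemma chartMul_left_unit : ∀ᶠ v in 𝓝 (extChartAt I (1 : G) 1),
    chartMul I G (extChartAt I (1 : G) 1, v) = v := by
  filter_upwards [extChartAt_target_mem_nhds (I := I) (1 : G)] with v hv
  rw [chartMul, extChartAt_to_inv, one_mul, (extChartAt I (1 : G)).right_inv hv]

lemma chartMul_right_unit : ∀ᶠ u in 𝓝 (extChartAt I (1 : G) 1),
    chartMul I G (u, extChartAt I (1 : G) 1) = u := by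
  filter_upwards [extChartAt_target_mem_nhds (I := I) (1 : G)] with v hv
  rw [chartMul, extChartAt_to_inv, mul_one, (extChartAt I (1 : G)).right_inv hv]

variable [LieGroup I ∞ G]

lemma contMDiffAt_extChartAt_symm_one : ContMDiffAt 𝓘(ℝ, E) I ∞ (extChartAt I (1 : G)).symm
    (extChartAt I (1 : G) 1) :=
  have : IsManifold I ∞ G := ContMDiffMul.toIsManifold
  (contMDiffOn_extChartAt_symm (1 : G)).contMDiffAt (extChartAt_target_mem_nhds (1 : G))

lemma contMDiffAt_symm_mul_symm :
    ContMDiffAt 𝓘(ℝ, E × E) I ∞ (fun z : E × E =>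
      (extChartAt I (1 : G)).symm z.1 * (extChartAt I (1 : G)).symm z.2)
      (extChartAt I (1 : G) 1, extChartAt I (1 : G) 1) := by
  have h := contMDiffAt_extChartAt_symm_one I G
  have h1 : ContMDiffAt 𝓘(ℝ, E × E) 𝓘(ℝ, E) ∞ (Prod.fst : E × E → E)
      (extChartAt I (1 : G) 1, extChartAt I (1 : G) 1) := contDiffAt_fst.contMDiffAt
  have h2 : ContMDiffAt 𝓘(ℝ, E × E) 𝓘(ℝ, E) ∞ (Prod.snd : E × E → E)
      (extChartAt I (1 : G) 1, extChartAt I (1 : G) 1) := contDiffAt_snd.contMDiffAt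
  exact (ContMDiffAt.comp (I' := 𝓘(ℝ, E)) (f := Prod.fst)
    (extChartAt I (1 : G) 1, extChartAt I (1 : G) 1) h h1).mul
    (ContMDiffAt.comp (I' := 𝓘(ℝ, E)) (f := Prod.snd)
      (extChartAt I (1 : G) 1, extChartAt I (1 : G) 1) h h2)

lemma contDiffAt_chartMul :
    ContDiffAt ℝ ∞ (chartMul I G) (extChartAt I (1 : G) 1, extChartAt I (1 : G) 1) := by
  have : IsManifold I ∞ G := ContMDiffMul.toIsManifold
  rw [← contMDiffAt_iff_contDiffAt]
  have h : ContMDiffAt I 𝓘(ℝ, E) ∞ (extChartAt I (1 : G)) (1 : G) := contMDiffAt_extChartAt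
  refine ContMDiffAt.comp (I' := I) (g := extChartAt I (1 : G))
    (f := fun z : E × E => (extChartAt I (1 : G)).symm z.1 * (extChartAt I (1 : G)).symm z.2)
    (extChartAt I (1 : G) 1, extChartAt I (1 : G) 1) ?_ (contMDiffAt_symm_mul_symm I G)
  simpa using h

/-- In the chart at the identity, `chartMul` is the multiplication. -/
lemma symm_chartMul : ∀ᶠ z in 𝓝 (extChartAt I (1 : G) 1, extChartAt I (1 : G) 1),
    (extChartAt I (1 : G)).symm (chartMul I G z) =
      (extChartAt I (1 : G)).symm z.1 * (extChartAt I (1 : G)).symm z.2 := by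
  have h := (contMDiffAt_symm_mul_symm I G).continuousAt.tendsto
  simp only [extChartAt_to_inv, mul_one] at h
  filter_upwards [h.eventually (extChartAt_source_mem_nhds (I := I) (1 : G))] with z hz
  exact (extChartAt I (1 : G)).left_inv hz

variable {G}

/-- The tangent space at `1` is identified with `E` through this very chart. -/
lemma mfderiv_extChartAt_one :
    (mfderiv I 𝓘(ℝ, E) (extChartAt I (1 : G)) (1 : G) : E →L[ℝ] E) =
      ContinuousLinearMap.id ℝ E := by
  have : IsManifold I ∞ G := ContMDiffMul.toIsManifold
  have h : ContMDiffAt I 𝓘(ℝ, E) ∞ (extChartAt I (1 : G)) (1 : G) := contMDiffAt_extChartAt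
  rw [(h.mdifferentiableAt (by simp)).mfderiv]
  have : writtenInExtChartAt I 𝓘(ℝ, E) (1 : G) (extChartAt I (1 : G)) =ᶠ[𝓝 (extChartAt I (1 : G) 1)]
      id := by
    filter_upwards [extChartAt_target_mem_nhds (I := I) (1 : G)] with v hv
    simpa [writtenInExtChartAt, chartAt_self_eq] using (extChartAt I (1 : G)).right_inv hv
  rw [I.range_eq_univ, fderivWithin_univ, this.fderiv_eq, fderiv_id]

lemma mfderiv_extChartAt_symm_one :
    (mfderiv 𝓘(ℝ, E) I (extChartAt I (1 : G)).symm (extChartAt I (1 : G) 1) : E →L[ℝ] E) =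
      ContinuousLinearMap.id ℝ E := by
  have : IsManifold I ∞ G := ContMDiffMul.toIsManifold
  rw [((contMDiffAt_extChartAt_symm_one I G).mdifferentiableAt (by simp)).mfderiv]
  have : writtenInExtChartAt 𝓘(ℝ, E) I (extChartAt I (1 : G) 1) (extChartAt I (1 : G)).symm
      =ᶠ[𝓝 (extChartAt I (1 : G) 1)] id := by
    filter_upwards [extChartAt_target_mem_nhds (I := I) (1 : G)] with v hv
    simpa [writtenInExtChartAt, chartAt_self_eq] using (extChartAt I (1 : G)).right_inv hv
  simp only [modelWithCornersSelf_coe, Set.range_id, fderivWithin_univ, extChartAt_model_space_eq_id,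
    PartialEquiv.refl_coe, id_eq]
  rw [this.fderiv_eq, fderiv_id]

/-- The left-invariant vector fields read in the chart at the identity. -/
lemma mpullbackWithin_mulInvariantVectorField (X : GroupLieAlgebra I G) :
    (mpullbackWithin 𝓘(ℝ, E) I (extChartAt I (1 : G)).symm (mulInvariantVectorField X)
      (Set.range I) : E → E) =ᶠ[𝓝 (extChartAt I (1 : G) 1)]
    fun u => fderiv ℝ (chartMul I G) (u, extChartAt I (1 : G) 1) (0, X) := by
  have : IsManifold I ∞ G := ContMDiffMul.toIsManifold
  have : IsManifold I 1 G := .of_le (n := ∞) (by simp)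
  set e := extChartAt I (1 : G) 1
  set φ := extChartAt I (1 : G)
  have hiu : ContinuousAt (fun u : E => (u, e)) e := by fun_prop
  have hdiff : ∀ᶠ u in 𝓝 e, DifferentiableAt ℝ (chartMul I G) (u, e) :=
    hiu.eventually (((contDiffAt_chartMul I G).of_le (m := 1) (by simp)).eventually (by simp)
      |>.mono fun z hz => hz.differentiableAt one_ne_zero)
  have hsymm := hiu.eventually (symm_chartMul I G).eventually_nhds
  filter_upwards [hdiff, hsymm, chartMul_right_unit I G,
    extChartAt_target_mem_nhds (I := I) (1 : G)] with u hu hs hr ht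
  have hinv := isInvertible_mfderivWithin_extChartAt_symm (I := I) ht
  refine hinv.inverse_apply_eq.2 ?_
  -- The base point `chartMul I G (u, e)` equals `u` only propositionally; quantifying over `w`
  -- avoids transport between tangent spaces.
  have hφu : ∀ w, w = u → HasMFDerivAt 𝓘(ℝ, E) I φ.symm w
      (mfderivWithin 𝓘(ℝ, E) I φ.symm (Set.range I) u : E →L[ℝ] E) := by
    rintro _ rfl
    rw [I.range_eq_univ, mfderivWithin_univ]
    exact (((contMDiffOn_extChartAt_symm (n := ∞) (1 : G)).contMDiffAt
      ((isOpen_extChartAt_target (I := I) (1 : G)).mem_nhds ht)).mdifferentiableAt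
        (by simp)).hasMFDerivAt
  have hφe : HasMFDerivAt 𝓘(ℝ, E) I φ.symm e (ContinuousLinearMap.id ℝ E) := by
    rw [← mfderiv_extChartAt_symm_one (I := I) (G := G)]
    exact ((contMDiffAt_extChartAt_symm_one I G).mdifferentiableAt (by simp)).hasMFDerivAt
  have hL : ∀ g : G, g = 1 → HasMFDerivAt I I (φ.symm u * ·) g
      (mfderiv I I (φ.symm u * ·) (1 : G) : E →L[ℝ] E) := by
    rintro _ rfl
    exact ((contMDiff_mul_left (I := I) (n := ∞)).mdifferentiableAt (by simp)).hasMFDerivAt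
  let M : E →L[ℝ] E := fderiv ℝ (chartMul I G) (u, e) ∘L ContinuousLinearMap.inr ℝ E E
  have hm : HasFDerivAt (fun v : E => chartMul I G (u, v)) M e :=
    HasFDerivAt.comp e (f := fun v : E => (u, v)) hu.hasFDerivAt (hasFDerivAt_prodMk_right u e)
  have h1 := HasMFDerivAt.comp e (hφu _ hr) hm.hasMFDerivAt
  have h2 := HasMFDerivAt.comp e (hL _ (extChartAt_to_inv (I := I) (1 : G))) hφe
  -- Left translation and `chartMul` agree through the chart; differentiating both sides at `e`
  -- identifies the fields.
  have h3 : (φ.symm ∘ fun v : E => chartMul I G (u, v)) =ᶠ[𝓝 e]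
      (fun g => φ.symm u * g) ∘ φ.symm :=
    (Continuous.tendsto (f := fun v : E => (u, v)) (by fun_prop) e).eventually hs
  have h4 := HasMFDerivAt.congr_of_eventuallyEq h2 h3
  have h5 := hasMFDerivAt_unique h4 h1
  have h6 : (mfderiv I I (φ.symm u * ·) (1 : G) : E →L[ℝ] E) ∘L ContinuousLinearMap.id ℝ E =
      (mfderivWithin 𝓘(ℝ, E) I φ.symm (Set.range I) u : E →L[ℝ] E) ∘L M := h5
  exact congrArg (fun L : E →L[ℝ] E => L X) h6

lemma bracket_eq_lieBracket_chart (A X : GroupLieAlgebra I G) :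
    (⁅A, X⁆ : GroupLieAlgebra I G) = lieBracket ℝ
      (fun u => fderiv ℝ (chartMul I G) (u, extChartAt I (1 : G) 1) (0, A))
      (fun u => fderiv ℝ (chartMul I G) (u, extChartAt I (1 : G) 1) (0, X))
      (extChartAt I (1 : G) 1) := by
  rw [GroupLieAlgebra.bracket_def, ← mlieBracketWithin_univ, mlieBracketWithin_apply]
  have h1 := mfderiv_extChartAt_one (I := I) (G := G)
  have h2 : ∀ v : E, (ContinuousLinearMap.id ℝ E).inverse v = v := by simp
  have h3 := Filter.EventuallyEq.lieBracket_vectorField_eq (𝕜 := ℝ) (E := E)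
    (mpullbackWithin_mulInvariantVectorField (G := G) I A)
    (mpullbackWithin_mulInvariantVectorField (G := G) I X)
  rw [← h3, I.range_eq_univ, Set.preimage_univ, Set.univ_inter]
  refine (congrArg (fun L : E →L[ℝ] E => L.inverse _) h1).trans ((h2 _).trans ?_)
  exact congrFun (lieBracketWithin_univ (𝕜 := ℝ) (E := E)) _

end AdjointDerivative

/-! ### The adjoint action along one-parameter subgroups. -/

section AdjointAction

open Filter Topology VectorField

variable {E : Type*} [NormedAddCommGroup E] [NormedSpace ℝ E]
  {H : Type*} [TopologicalSpace H] {I : ModelWithCorners ℝ E H}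
  {G : Type*} [TopologicalSpace G] [ChartedSpace H G] [Group G]

lemma adjointAction_one (X : GroupLieAlgebra I G) : adjointAction I (1 : G) X = X := by
  have h : HasMFDerivAt I I (fun y : G => 1 * y * 1⁻¹) 1 (ContinuousLinearMap.id ℝ E) := by
    have he : (fun y : G => 1 * y * 1⁻¹) = id := by ext; simp
    rw [he]
    exact hasMFDerivAt_id (I := I) (1 : G)
  have h1 : adjointAction I (1 : G) = (ContinuousLinearMap.id ℝ E) := h.mfderiv
  rw [h1]; rfl

namespace IsOneParameterSubgroup

variable {γ : ℝ → G} {A : GroupLieAlgebra I G}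

lemma map_zero (h : IsOneParameterSubgroup I γ A) : γ 0 = 1 := by
  simpa using h.map_add 0 0

lemma map_neg (h : IsOneParameterSubgroup I γ A) (t : ℝ) : γ (-t) = (γ t)⁻¹ := by
  rw [eq_inv_iff_mul_eq_one, ← h.map_add, neg_add_cancel, h.map_zero]

end IsOneParameterSubgroup

variable [LieGroup I ∞ G]

variable (I) in
lemma mdifferentiable_conj (x : G) : MDifferentiable I I (fun y : G => x * y * x⁻¹) :=
  ((contMDiff_mul_left (n := ∞) (a := x)).mul contMDiff_const).mdifferentiable (by simp)

lemma adjointAction_mul (x y : G) (X : GroupLieAlgebra I G) :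
    adjointAction I (x * y) X = adjointAction I x (adjointAction I y X) := by
  have hx : ∀ z : G, z = 1 → HasMFDerivAt I I (fun y : G => x * y * x⁻¹) z
      (adjointAction I x : E →L[ℝ] E) := by
    rintro _ rfl
    exact (mdifferentiable_conj I x 1).hasMFDerivAt
  have hy := (mdifferentiable_conj I y 1).hasMFDerivAt
  have h := HasMFDerivAt.comp (1 : G) (hx (y * 1 * y⁻¹) (by simp)) hy
  have hxy := (mdifferentiable_conj I (x * y) 1).hasMFDerivAt
  have he : (fun z : G => x * y * z * (x * y)⁻¹) =
      (fun z : G => x * z * x⁻¹) ∘ fun z : G => y * z * y⁻¹ := by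
    ext z; simp [mul_assoc]
  rw [he] at hxy
  have h1 := hasMFDerivAt_unique hxy h
  have h2 : (adjointAction I (x * y) : E →L[ℝ] E) =
      (adjointAction I x : E →L[ℝ] E) ∘L (adjointAction I y : E →L[ℝ] E) := by
    rw [← he] at h1
    exact h1
  exact congrArg (fun L : E →L[ℝ] E => L X) h2

variable [I.Boundaryless]

/-- The adjoint action of an element near the identity, read in the chart at the identity. -/
lemma adjointAction_eq_fderiv {x : G} (hx : x ∈ (extChartAt I (1 : G)).source)
    (hx' : x⁻¹ ∈ (extChartAt I (1 : G)).source) (X : GroupLieAlgebra I G) :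
    adjointAction I x X = fderiv ℝ (fun v => chartMul I G
      (chartMul I G (extChartAt I (1 : G) x, v), extChartAt I (1 : G) x⁻¹))
      (extChartAt I (1 : G) 1) X := by
  have h1 : ∀ᶠ v in 𝓝 (extChartAt I (1 : G) 1),
      x * (extChartAt I (1 : G)).symm v ∈ (extChartAt I (1 : G)).source := by
    have : ContinuousAt (fun v => x * (extChartAt I (1 : G)).symm v) (extChartAt I (1 : G) 1) := by
      have h2 := (contMDiff_mul_left (I := I) (n := ∞) (a := x)).continuous
      exact h2.continuousAt.comp (contMDiffAt_extChartAt_symm_one I G).continuousAt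
    refine this.eventually ((isOpen_extChartAt_source (I := I) (1 : G)).mem_nhds ?_)
    simpa using hx
  have h2 : (fun v => chartMul I G
      (chartMul I G (extChartAt I (1 : G) x, v), extChartAt I (1 : G) x⁻¹))
      =ᶠ[𝓝 (extChartAt I (1 : G) 1)]
      extChartAt I (1 : G) ∘ (fun y : G => x * y * x⁻¹) ∘ (extChartAt I (1 : G)).symm := by
    filter_upwards [h1] with v hv
    simp only [chartMul, Function.comp_apply]
    rw [(extChartAt I (1 : G)).left_inv hx, (extChartAt I (1 : G)).left_inv hx',
      (extChartAt I (1 : G)).left_inv hv]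
  have h3 : adjointAction I x = fderivWithin ℝ
      (extChartAt I (x * 1 * x⁻¹) ∘ (fun y : G => x * y * x⁻¹) ∘ (extChartAt I (1 : G)).symm)
      (Set.range I) (extChartAt I (1 : G) 1) := (mdifferentiable_conj I x 1).mfderiv
  rw [h3, h2.fderiv_eq, I.range_eq_univ, fderivWithin_univ, mul_one, mul_inv_cancel]
  rfl

namespace IsOneParameterSubgroup

variable {γ : ℝ → G} {A : GroupLieAlgebra I G}

lemma hasDerivAt_chart (h : IsOneParameterSubgroup I γ A) :
    HasDerivAt (fun t => extChartAt I (1 : G) (γ t)) (A : E) 0 := by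
  have : IsManifold I ∞ G := ContMDiffMul.toIsManifold
  have hφ : ∀ z : G, z = 1 → HasMFDerivAt I 𝓘(ℝ, E) (extChartAt I (1 : G)) z
      (ContinuousLinearMap.id ℝ E) := by
    rintro _ rfl
    rw [← mfderiv_extChartAt_one (I := I) (G := G)]
    exact ((contMDiffAt_extChartAt (n := ∞)).mdifferentiableAt (by simp)).hasMFDerivAt
  have hγ := (h.smooth.mdifferentiable (by simp) 0).hasMFDerivAt
  have h1 := HasMFDerivAt.comp (0 : ℝ) (hφ _ h.map_zero) hγ
  have h2 : HasFDerivAt (fun t => extChartAt I (1 : G) (γ t))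
      (ContinuousLinearMap.id ℝ E ∘L (mfderiv 𝓘(ℝ, ℝ) I γ 0 : ℝ →L[ℝ] E)) 0 :=
    h1.hasFDerivAt
  have h3 := h2.hasDerivAt
  have h4 : (ContinuousLinearMap.id ℝ E ∘L (mfderiv 𝓘(ℝ, ℝ) I γ 0 : ℝ →L[ℝ] E)) 1 = (A : E) :=
    h.velocity
  exact h4 ▸ h3

/-- The derivative at `0` of `Ad (exp (t A)) X` is `[A, X]`. -/
lemma hasDerivAt_adjointAction_zero (h : IsOneParameterSubgroup I γ A)
    (X : GroupLieAlgebra I G) :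
    HasDerivAt (fun t => (adjointAction I (γ t) X : E)) (⁅A, X⁆ : GroupLieAlgebra I G) 0 := by
  have hp := h.hasDerivAt_chart
  have hq : HasDerivAt (fun t => extChartAt I (1 : G) (γ (-t))) (-A : E) 0 := by
    have h1 : HasDerivAt (fun t => extChartAt I (1 : G) (γ t)) (A : E) (0 - 0) := by
      rwa [sub_zero]
    have h2 := h1.comp_const_sub 0 0
    simp only [zero_sub] at h2
    exact h2
  have key := hasDerivAt_fderiv_conj
    ((contDiffAt_chartMul I G).of_le (m := 2) (WithTop.coe_le_coe.2 le_top)) (chartMul_left_unit I G)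
    (chartMul_right_unit I G) hp hq (by rw [h.map_zero]) (by rw [neg_zero, h.map_zero]) X
  rw [bracket_eq_lieBracket_chart]
  refine key.congr_of_eventuallyEq ?_
  have hsource : ∀ᶠ t in 𝓝 (0 : ℝ), γ t ∈ (extChartAt I (1 : G)).source :=
    h.smooth.continuous.continuousAt.eventually
      (by rw [h.map_zero]; exact extChartAt_source_mem_nhds (I := I) (1 : G))
  have hneg : Tendsto (fun t : ℝ => -t) (𝓝 0) (𝓝 0) := by
    simpa using (continuous_neg (G := ℝ)).tendsto 0
  filter_upwards [hsource, hneg.eventually hsource] with t ht ht'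
  rw [h.map_neg] at ht' ⊢
  exact adjointAction_eq_fderiv ht ht' X

/-- The factorization `Ad (γ t) = Ad (γ s) Ad (γ (t - s))` moves the computation to time zero. -/
lemma hasDerivAt_adjointAction (h : IsOneParameterSubgroup I γ A)
    (X : GroupLieAlgebra I G) (s : ℝ) :
    HasDerivAt (fun t => (adjointAction I (γ t) X : E)) (adjointAction I (γ s) ⁅A, X⁆) s := by
  let L : E →L[ℝ] E := adjointAction I (γ s)
  let f : ℝ → E := fun t => adjointAction I (γ t) X
  have h1 : HasDerivAt f (⁅A, X⁆ : GroupLieAlgebra I G) (s - s) := by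
    rw [sub_self]; exact h.hasDerivAt_adjointAction_zero X
  have h2 := L.hasFDerivAt.comp_hasDerivAt s (h1.comp_sub_const s s)
  refine h2.congr_of_eventuallyEq (Eventually.of_forall fun t => ?_)
  change adjointAction I (γ t) X = adjointAction I (γ s) (adjointAction I (γ (t - s)) X)
  rw [← adjointAction_mul, ← h.map_add, add_sub_cancel]

/-- On an eigenvector of `ad A`, `Ad (exp (t A))` is the exponential of the eigenvalue. -/
lemma adjointAction_apply_of_lie_eq_smul (h : IsOneParameterSubgroup I γ A)
    {X : GroupLieAlgebra I G} {c : ℝ} (hX : ⁅A, X⁆ = c • X) (t : ℝ) :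
    adjointAction I (γ t) X = Real.exp (c * t) • X := by
  let f : ℝ → E := fun t => adjointAction I (γ t) X
  have hf : ∀ s, HasDerivAt f (c • f s) s := by
    intro s
    have := h.hasDerivAt_adjointAction X s
    rw [hX, map_smul] at this
    exact this
  -- The integrating factor `exp (-c s)` makes the solution of `f' = c f` constant.
  have hg : ∀ s, HasDerivAt (fun s => Real.exp (-(c * s)) • f s) 0 s := by
    intro s
    have h1 : HasDerivAt (fun s => Real.exp (-(c * s))) (Real.exp (-(c * s)) * -c) s := by
      simpa using ((hasDerivAt_id s).const_mul c).neg.exp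
    have h2 := h1.smul (hf s)
    rw [smul_smul, ← add_smul, mul_neg, add_neg_cancel, zero_smul] at h2
    exact h2
  have hconst := is_const_of_deriv_eq_zero (fun s => (hg s).differentiableAt)
    (fun s => (hg s).deriv) t 0
  have hf0 : f 0 = X := by
    change adjointAction I (γ 0) X = X
    rw [h.map_zero, adjointAction_one]
  simp only [mul_zero, neg_zero, Real.exp_zero] at hconst
  have h1 : f t = Real.exp (c * t) • f 0 := by
    rw [← one_smul ℝ (f 0), ← hconst, smul_smul, ← Real.exp_add, add_neg_cancel, Real.exp_zero,
      one_smul]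
  exact h1.trans (congrArg (fun Y : E => Real.exp (c * t) • Y) hf0)

end IsOneParameterSubgroup

/-- If `h` acts on `N` by scalars, then the connected subgroup with Lie algebra `h` acts on `N` by
positive scalars. -/
lemma exists_pos_adjointAction_eq_smul [CompleteSpace E]
    (h : LieSubalgebra ℝ (GroupLieAlgebra I G)) (N : Submodule ℝ (GroupLieAlgebra I G))
    (hN : ∀ A ∈ h, ∃ c : ℝ, ∀ X ∈ N, ⁅A, X⁆ = c • X) {x : G} (hx : x ∈ connectedSubgroup I h) :
    ∃ c : ℝ, 0 < c ∧ ∀ X ∈ N, adjointAction I x X = c • X := by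
  unfold connectedSubgroup at hx
  induction hx using Subgroup.closure_induction with
  | mem x hx =>
    obtain ⟨A, hA, γ, hγ, rfl⟩ := hx
    obtain ⟨c, hc⟩ := hN A hA
    exact ⟨_, Real.exp_pos _, fun X hX =>
      hγ.adjointAction_apply_of_lie_eq_smul (hc X hX) 1⟩
  | one => exact ⟨1, one_pos, fun X _ => by rw [adjointAction_one, one_smul]⟩
  | mul x y _ _ hx hy =>
    obtain ⟨c, hc, hcX⟩ := hx
    obtain ⟨d, hd, hdX⟩ := hy
    exact ⟨d * c, mul_pos hd hc, fun X hX => by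
      rw [adjointAction_mul, hdX X hX, map_smul, hcX X hX, smul_smul]⟩
  | inv x _ hx =>
    obtain ⟨c, hc, hcX⟩ := hx
    refine ⟨c⁻¹, inv_pos.2 hc, fun X hX => ?_⟩
    have h1 : adjointAction I x⁻¹ (adjointAction I x X) = X := by
      rw [← adjointAction_mul, inv_mul_cancel, adjointAction_one]
    rw [hcX X hX, map_smul] at h1
    rw [eq_inv_smul_iff₀ hc.ne', h1]

end AdjointAction

theorem mainTheorem6 (n : ℕ) {G : Type*} [TopologicalSpace G]
    [ChartedSpace (EuclideanSpace ℝ (Fin n)) G] [Group G] [LieGroup (𝓡 n) ∞ G]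
    (hsimple : LieAlgebra.IsSimple ℂ (ℂ ⊗[ℝ] GroupLieAlgebra (𝓡 n) G))
    (P : StandardParabolic (GroupLieAlgebra (𝓡 n) G))
    (hlevi : ∀ X ∈ P.nilPlus, ∀ Y ∈ P.nilMinus, ⁅X, Y⁆ ∈ P.levi) :
    LieModule.IsIrreducible ℝ P.lorentz P.nilPlus ∧
      ∀ x ∈ connectedSubgroup (𝓡 n) P.dilatation,
        ∃ c : ℝ, 0 < c ∧ ∀ X ∈ P.nilPlus, adjointAction (𝓡 n) x X = c • X := by
  have hfin : FiniteDimensional ℝ (GroupLieAlgebra (𝓡 n) G) :=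
    inferInstanceAs (FiniteDimensional ℝ (EuclideanSpace ℝ (Fin n)))
  have hg := LieIdeal.eq_bot_or_eq_top_of_isSimple_complexification hsimple
  exact ⟨P.isIrreducible_nilPlus hg hlevi, fun x hx =>
    exists_pos_adjointAction_eq_smul P.dilatation P.nilPlus.toSubmodule
      (fun A hA => P.exists_dilatation_scalar hg hlevi hA) hx⟩
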